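/- Let $A=[A(i,j)]_{i,j=1}^N$ and $B=[B(i,j)]_{i,j=1}^M$ be irreducible, non-permutation square matrices with entries in $\{0,1\}$. For such an $A$, let $\bar X_A=\{(x_n)_{n\in\mathbb Z}\in\{1,\dots,N\}^{\mathbb Z} : A(x_n,x_{n+1})=1 \text{ for all } n\in\mathbb Z\}$, with the topology induced by the product topology, and let $\bar\sigma_A((x_n)_n)=(x_{n+1})_n$ be the shift homeomorphism. Let $\Delta_A$ be the inductive limit of $\mathbb Z^N\xrightarrow{A^t}\mathbb Z^N\xrightarrow{A^t}\cdots$, and write $[v,n]$ ($v\in\mathbb Z^N$, $n\ge 0$) for the class of $v$ at stage $n$, so that $[v,n]=[A^tv,n+1]$. Put $\Delta_A^+=\{[v,n] : v\in\mathbb Z_{\ge 0}^N,\ n\ge 0\}$, and let $\delta_A$ be the automorphism $\delta_A([v,n])=[v,n+1]$ of $\Delta_A$. The *dimension quadruplet* $(\tilde\Delta_A,\tilde\Delta_A^+,\tilde\delta_A,\tilde u_A)$ of $(\bar X_A,\bar\sigma_A)$ consists of $$\tilde\Delta_A=\Delta_{A^t}\otimes_{\mathbb Z}\Delta_A,\qquad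 \tilde\delta_A=\delta_{A^t}^{-1}\otimes\delta_A,\qquad \tilde u_A=\sum_{i,j=1}^N [e_j,1]\otimes A(j,i)[e_i,1],$$ where $e_1,\dots,e_N$ is the standard basis of $\mathbb Z^N$, together with the positive cone $\tilde\Delta_A^+=\Delta_{A^t}^+\otimes\Delta_A^+$, that is, the set of all finite sums of elements $a\otimes b$ with $a\in\Delta_{A^t}^+$ and $b\in\Delta_A^+$. **Proposition.** The dimension quadruplet is invariant under topological conjugacy of two-sided topological Markov shifts: if there is a homeomorphism $h:\bar X_A\to\bar X_B$ with $h\circ\bar\sigma_A=\bar\sigma_B\circ h$, then there is a group isomorphism $\Phi:\tilde\Delta_A\to\tilde\Delta_B$ such that $\Phi(\tilde\Delta_A^+)=\tilde\Delta_B^+$, $\Phi\circ\tilde\delta_A=\tilde\delta_B\circ\Phi$ and $\Phi(\tilde u_A)=\tilde u_B$. -/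

import Mathlib

open scoped TensorProduct

/-! ### Two-sided topological Markov shifts -/

/-- The two-sided shift space of a `0`-`1` matrix `A`: bi-infinite sequences of symbols all of whose
transitions are allowed by `A`.  It carries the subspace topology of the product topology. -/
def MarkovShift {ι : Type*} (A : Matrix ι ι ℤ) : Set (ℤ → ι) :=
  {x | ∀ n : ℤ, A (x n) (x (n + 1)) = 1}

/-- The shift homeomorphism `(x_n)_n ↦ (x_{n+1})_n` of the shift space. -/
def markovShiftMap {ι : Type*} [TopologicalSpace ι] (A : Matrix ι ι ℤ) :
    MarkovShift A ≃ₜ MarkovShift A where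
  toFun x := ⟨fun n => x.1 (n + 1), fun n => x.2 (n + 1)⟩
  invFun x := ⟨fun n => x.1 (n - 1), fun n => by
    have h := x.2 (n - 1)
    rwa [show n - 1 + 1 = n + 1 - 1 by ring] at h⟩
  left_inv x := by
    apply Subtype.ext
    funext n
    simp
  right_inv x := by
    apply Subtype.ext
    funext n
    simp
  continuous_toFun := by
    refine Continuous.subtype_mk (continuous_pi fun n => ?_) _
    exact (continuous_apply (n + 1)).comp continuous_subtype_val
  continuous_invFun := by
    refine Continuous.subtype_mk (continuous_pi fun n => ?_) _
    exact (continuous_apply (n - 1)).comp continuous_subtype_val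

/-- Topological conjugacy of the two-sided topological Markov shifts of `A` and `B`. -/
def TopologicallyConjugate {ι κ : Type*} [TopologicalSpace ι] [TopologicalSpace κ]
    (A : Matrix ι ι ℤ) (B : Matrix κ κ ℤ) : Prop :=
  ∃ h : MarkovShift A ≃ₜ MarkovShift B, ∀ x, h (markovShiftMap A x) = markovShiftMap B (h x)

/-- `A` is the matrix of a permutation. -/
def IsPermutationMatrix {ι : Type*} [DecidableEq ι] (A : Matrix ι ι ℤ) : Prop :=
  ∃ σ : Equiv.Perm ι, A = σ.permMatrix ℤ

noncomputable section

/-! ### The dimension triplet -/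

section Dimension

variable {ι : Type*} [Fintype ι] [DecidableEq ι]

/-- The connecting map from stage `i` to stage `j` of `ℤ^N → ℤ^N → ⋯`, every single step of which is
multiplication by the transpose of `A`. -/
def dimMap (A : Matrix ι ι ℤ) (i j : ℕ) (_ : i ≤ j) : (ι → ℤ) →ₗ[ℤ] (ι → ℤ) :=
  (A.transpose ^ (j - i)).mulVecLin

/-- The dimension group `Δ_A`, the inductive limit of `ℤ^N → ℤ^N → ⋯` along `Aᵗ`. -/
def DimGroup (A : Matrix ι ι ℤ) : Type _ :=
  Module.DirectLimit (fun _ : ℕ => ι → ℤ) (dimMap A)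

instance (A : Matrix ι ι ℤ) : AddCommGroup (DimGroup A) :=
  inferInstanceAs (AddCommGroup (Module.DirectLimit (fun _ : ℕ => ι → ℤ) (dimMap A)))

/-- The class `[v, n]` in `Δ_A` of the vector `v` at stage `n`. -/
def dimClass (A : Matrix ι ι ℤ) (v : ι → ℤ) (n : ℕ) : DimGroup A :=
  Module.DirectLimit.of ℤ ℕ (fun _ : ℕ => ι → ℤ) (dimMap A) n v

/-- The positive cone `Δ_A⁺`: the classes of nonnegative vectors. -/
def dimCone (A : Matrix ι ι ℤ) : Set (DimGroup A) :=
  {x | ∃ (v : ι → ℤ) (n : ℕ), 0 ≤ v ∧ x = dimClass A v n}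

theorem exists_dimClass (A : Matrix ι ι ℤ) (x : DimGroup A) :
    ∃ (v : ι → ℤ) (n : ℕ), x = dimClass A v n := by
  obtain ⟨n, v, h⟩ := Module.DirectLimit.exists_of x
  exact ⟨v, n, h.symm⟩

/-- The defining relation `[v, n] = [Aᵗ v, n + 1]`. -/
theorem dimClass_succ (A : Matrix ι ι ℤ) (v : ι → ℤ) (n : ℕ) :
    dimClass A (A.transpose.mulVec v) (n + 1) = dimClass A v n := by
  have h := Module.DirectLimit.of_f (R := ℤ) (ι := ℕ) (G := fun _ : ℕ => ι → ℤ) (f := dimMap A)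
    (i := n) (j := n + 1) (hij := Nat.le_succ n) (x := v)
  have e : dimMap A n (n + 1) (Nat.le_succ n) v = A.transpose.mulVec v := by
    simp only [dimMap, Nat.add_sub_cancel_left, pow_one, Matrix.mulVecLin_apply]
  rw [e] at h
  exact h

theorem dimShift_compat (A : Matrix ι ι ℤ) (i j : ℕ) (hij : i ≤ j) (v : ι → ℤ) :
    Module.DirectLimit.of ℤ ℕ (fun _ : ℕ => ι → ℤ) (dimMap A) (j + 1) (dimMap A i j hij v) =
      Module.DirectLimit.of ℤ ℕ (fun _ : ℕ => ι → ℤ) (dimMap A) (i + 1) v := by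
  have h := Module.DirectLimit.of_f (R := ℤ) (ι := ℕ) (G := fun _ : ℕ => ι → ℤ)
    (f := dimMap A) (i := i + 1) (j := j + 1) (hij := Nat.succ_le_succ hij) (x := v)
  have e : dimMap A (i + 1) (j + 1) (Nat.succ_le_succ hij) v = dimMap A i j hij v := by
    simp only [dimMap, Nat.add_sub_add_right]
  rw [e] at h
  exact h

theorem dimUnshift_compat (A : Matrix ι ι ℤ) (i j : ℕ) (hij : i ≤ j) :
    A.transpose.mulVecLin ∘ₗ dimMap A i j hij = dimMap A i j hij ∘ₗ A.transpose.mulVecLin := by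
  simp only [dimMap, ← Matrix.mulVecLin_mul]
  rw [← pow_succ, ← pow_succ']

/-- The endomorphism `[v, n] ↦ [v, n + 1]` of `Δ_A`. -/
def dimShift (A : Matrix ι ι ℤ) : DimGroup A →+ DimGroup A :=
  LinearMap.toAddMonoidHom (Module.DirectLimit.lift ℤ ℕ (fun _ : ℕ => ι → ℤ) (dimMap A)
    (fun n => Module.DirectLimit.of ℤ ℕ (fun _ : ℕ => ι → ℤ) (dimMap A) (n + 1))
    (dimShift_compat A))

/-- The endomorphism `[v, n] ↦ [Aᵗ v, n]` of `Δ_A`. -/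
def dimUnshift (A : Matrix ι ι ℤ) : DimGroup A →+ DimGroup A :=
  LinearMap.toAddMonoidHom (Module.DirectLimit.map (f := dimMap A) (f' := dimMap A)
    (fun _ => A.transpose.mulVecLin) (dimUnshift_compat A))

theorem dimShift_dimClass (A : Matrix ι ι ℤ) (v : ι → ℤ) (n : ℕ) :
    dimShift A (dimClass A v n) = dimClass A v (n + 1) :=
  Module.DirectLimit.lift_of
    (fun n => Module.DirectLimit.of ℤ ℕ (fun _ : ℕ => ι → ℤ) (dimMap A) (n + 1))
    (dimShift_compat A) v

theorem dimUnshift_dimClass (A : Matrix ι ι ℤ) (v : ι → ℤ) (n : ℕ) :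
    dimUnshift A (dimClass A v n) = dimClass A (A.transpose.mulVec v) n :=
  Module.DirectLimit.map_apply_of (fun _ => A.transpose.mulVecLin) (dimUnshift_compat A) v

/-- The dimension drop automorphism `δ_A`, `[v, n] ↦ [v, n + 1]`, with inverse
`[v, n] ↦ [Aᵗ v, n]`. -/
def dimAut (A : Matrix ι ι ℤ) : DimGroup A ≃+ DimGroup A where
  toFun := dimShift A
  map_add' := map_add (dimShift A)
  invFun := dimUnshift A
  left_inv x := by
    obtain ⟨v, n, rfl⟩ := exists_dimClass A x
    rw [dimShift_dimClass, dimUnshift_dimClass, dimClass_succ]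
  right_inv x := by
    obtain ⟨v, n, rfl⟩ := exists_dimClass A x
    rw [dimUnshift_dimClass, dimShift_dimClass, dimClass_succ]

/-! ### The dimension quadruplet -/

/-- The bilateral dimension group `Δ_{Aᵗ} ⊗ Δ_A`. -/
abbrev BiDimGroup (A : Matrix ι ι ℤ) : Type _ :=
  DimGroup A.transpose ⊗[ℤ] DimGroup A

/-- The positive cone `Δ_{Aᵗ}⁺ ⊗ Δ_A⁺`: all finite sums of `a ⊗ b` with `a` and `b` positive. -/
def biDimCone (A : Matrix ι ι ℤ) : AddSubmonoid (BiDimGroup A) :=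
  AddSubmonoid.closure
    {z | ∃ a ∈ dimCone A.transpose, ∃ b ∈ dimCone A, z = a ⊗ₜ[ℤ] b}

/-- The automorphism `δ_{Aᵗ}⁻¹ ⊗ δ_A`. -/
def biDimAut (A : Matrix ι ι ℤ) : BiDimGroup A ≃+ BiDimGroup A :=
  (TensorProduct.congr (dimAut A.transpose).symm.toIntLinearEquiv
    (dimAut A).toIntLinearEquiv).toAddEquiv

/-- The distinguished element `∑_{i,j} [e_j, 1] ⊗ A(j,i) [e_i, 1]`. -/
def biDimUnit (A : Matrix ι ι ℤ) : BiDimGroup A :=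
  ∑ i : ι, ∑ j : ι,
    dimClass A.transpose (Pi.single j 1) 1 ⊗ₜ[ℤ] (A j i • dimClass A (Pi.single i 1) 1)

/-- Isomorphism of the dimension quadruplets of `A` and `B`: a group isomorphism that maps positive
cone onto positive cone, intertwines the automorphisms and matches the distinguished elements. -/
def DimQuadrupletIso {κ : Type*} [Fintype κ] [DecidableEq κ]
    (A : Matrix ι ι ℤ) (B : Matrix κ κ ℤ) : Prop :=
  ∃ Φ : BiDimGroup A ≃+ BiDimGroup B,
    Φ '' (biDimCone A : Set (BiDimGroup A)) = (biDimCone B : Set (BiDimGroup B)) ∧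
    (∀ z, Φ (biDimAut A z) = biDimAut B (Φ z)) ∧
    Φ (biDimUnit A) = biDimUnit B

end Dimension

end

/-!
Present one system as the Markov shift of several matrices, fix a reference point for every
symbol, and count the points whose past up to time `0` is a reference past for `A` and whose future
from time `n` on is a reference future for `B`. The presentations determine one another through
finite windows, so a counted point can be cut at an intermediate time into two, which makes the
counting matrices multiply. Those from `A` to `A` are the powers of `A`, so for large `n` the
matrices `R` from `A` to `B` and `S` from `B` to `A` are a shift equivalence.

A shift equivalence of lag `l` induces isomorphisms `[v, n] ↦ [S v, n]` of the dimension triplets of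
the transposes and `[v, n] ↦ [Rᵗ v, n + l]` of those of the matrices themselves. Their tensor
product is the required isomorphism: since `ũ_A = ∑ [e_k, 1] ⊗ [e_k, 0]`, moving `S` across the
tensor product turns the image of `ũ_A` into `∑ [e_k, 1] ⊗ [(S R)ᵗ e_k, l]`, and `S R = B ^ l`.
-/

/-! ### Shift equivalence -/

section ShiftEquivalence

open scoped Matrix

variable {ι κ : Type*} [Fintype ι] [DecidableEq ι] [Fintype κ] [DecidableEq κ]
  {A : Matrix ι ι ℤ} {B : Matrix κ κ ℤ} {R : Matrix ι κ ℤ} {S : Matrix κ ι ℤ} {l : ℕ}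

/-- Williams' shift equivalence of lag `l` over the nonnegative integers: `R` and `S` intertwine `A`
and `B`, and their products are the `l`-th powers. -/
structure IsShiftEquivalence (A : Matrix ι ι ℤ) (B : Matrix κ κ ℤ) (R : Matrix ι κ ℤ)
    (S : Matrix κ ι ℤ) (l : ℕ) : Prop where
  left_nonneg : ∀ i k, 0 ≤ R i k
  right_nonneg : ∀ k i, 0 ≤ S k i
  mul_left : A * R = R * B
  mul_right : B * S = S * A
  left_mul_right : R * S = A ^ l
  right_mul_left : S * R = B ^ l

theorem IsShiftEquivalence.symm (h : IsShiftEquivalence A B R S l) :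
    IsShiftEquivalence B A S R l :=
  ⟨h.right_nonneg, h.left_nonneg, h.mul_right, h.mul_left, h.right_mul_left, h.left_mul_right⟩

theorem IsShiftEquivalence.transpose (h : IsShiftEquivalence A B R S l) :
    IsShiftEquivalence Aᵀ Bᵀ Sᵀ Rᵀ l where
  left_nonneg i k := h.right_nonneg k i
  right_nonneg k i := h.left_nonneg i k
  mul_left := by rw [← Matrix.transpose_mul, ← h.mul_right, Matrix.transpose_mul]
  mul_right := by rw [← Matrix.transpose_mul, ← h.mul_left, Matrix.transpose_mul]
  left_mul_right := by rw [← Matrix.transpose_mul, h.left_mul_right, Matrix.transpose_pow]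
  right_mul_left := by rw [← Matrix.transpose_mul, h.right_mul_left, Matrix.transpose_pow]

theorem pow_mul_eq_mul_pow_of_mul_eq_mul {α : Type*} [Semiring α] {A : Matrix ι ι α}
    {B : Matrix κ κ α} {R : Matrix ι κ α} (h : A * R = R * B) (n : ℕ) :
    A ^ n * R = R * B ^ n := by
  induction n with
  | zero => simp only [pow_zero, Matrix.one_mul, Matrix.mul_one]
  | succ n ih => rw [pow_succ, Matrix.mul_assoc, h, ← Matrix.mul_assoc, ih, Matrix.mul_assoc,
      pow_succ]

theorem mulVec_nonneg_of_nonneg {α m n : Type*} [Fintype n] [Semiring α] [PartialOrder α]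
    [IsOrderedRing α] {T : Matrix m n α} (hT : ∀ i j, 0 ≤ T i j) {v : n → α} (hv : 0 ≤ v) :
    0 ≤ T *ᵥ v :=
  fun i => Finset.sum_nonneg fun j _ => mul_nonneg (hT i j) (hv j)

/-! ### Dimension groups -/

/-- The class map `[·, n]` of `Δ_A` as a homomorphism. -/
noncomputable def dimClassHom (A : Matrix ι ι ℤ) (n : ℕ) : (ι → ℤ) →+ DimGroup A :=
  (Module.DirectLimit.of ℤ ℕ (fun _ : ℕ => ι → ℤ) (dimMap A) n).toAddMonoidHom

theorem dimClassHom_apply (A : Matrix ι ι ℤ) (v : ι → ℤ) (n : ℕ) :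
    dimClassHom A n v = dimClass A v n :=
  rfl

theorem dimClass_pow_mulVec (A : Matrix ι ι ℤ) (v : ι → ℤ) (n k : ℕ) :
    dimClass A ((Aᵀ ^ k) *ᵥ v) (n + k) = dimClass A v n := by
  induction k with
  | zero => simp only [pow_zero, Matrix.one_mulVec, add_zero]
  | succ k ih => rw [pow_succ', ← Matrix.mulVec_mulVec, ← add_assoc, dimClass_succ, ih]

theorem dimAut_dimClass (A : Matrix ι ι ℤ) (v : ι → ℤ) (n : ℕ) :
    dimAut A (dimClass A v n) = dimClass A v (n + 1) :=
  dimShift_dimClass A v n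

theorem dimAut_iterate_dimClass (A : Matrix ι ι ℤ) (v : ι → ℤ) (n k : ℕ) :
    (dimAut A)^[k] (dimClass A v n) = dimClass A v (n + k) := by
  induction k with
  | zero => rfl
  | succ k ih => rw [Function.iterate_succ_apply', ih, dimAut_dimClass, add_assoc]

theorem dimAut_iterate_mem_dimCone {x : DimGroup A} (hx : x ∈ dimCone A) (k : ℕ) :
    (dimAut A)^[k] x ∈ dimCone A := by
  obtain ⟨v, n, hv, rfl⟩ := hx
  exact ⟨v, n + k, hv, dimAut_iterate_dimClass A v n k⟩

theorem mulVecLin_comp_dimMap (h : A * R = R * B) (i j : ℕ) (hij : i ≤ j) :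
    Rᵀ.mulVecLin ∘ₗ dimMap A i j hij = dimMap B i j hij ∘ₗ Rᵀ.mulVecLin := by
  simp only [dimMap, ← Matrix.mulVecLin_mul, ← Matrix.transpose_pow, ← Matrix.transpose_mul,
    pow_mul_eq_mul_pow_of_mul_eq_mul h]

/-- The homomorphism `Δ_A → Δ_B`, `[v, n] ↦ [Rᵗ v, n]`, induced by a matrix intertwining `A` and
`B`. -/
noncomputable def dimHom (R : Matrix ι κ ℤ) (h : A * R = R * B) : DimGroup A →+ DimGroup B :=
  (Module.DirectLimit.map (f := dimMap A) (f' := dimMap B) (fun _ => Rᵀ.mulVecLin)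
    (mulVecLin_comp_dimMap h)).toAddMonoidHom

theorem dimHom_dimClass (h : A * R = R * B) (v : ι → ℤ) (n : ℕ) :
    dimHom R h (dimClass A v n) = dimClass B (Rᵀ *ᵥ v) n :=
  Module.DirectLimit.map_apply_of (fun _ => Rᵀ.mulVecLin) (mulVecLin_comp_dimMap h) v

theorem dimHom_mem_dimCone (h : A * R = R * B) (hR : ∀ i k, 0 ≤ R i k) {x : DimGroup A}
    (hx : x ∈ dimCone A) : dimHom R h x ∈ dimCone B := by
  obtain ⟨v, n, hv, rfl⟩ := hx
  exact ⟨_, n, mulVec_nonneg_of_nonneg (fun k i => hR i k) hv, dimHom_dimClass h v n⟩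

theorem dimHom_dimAut (h : A * R = R * B) (x : DimGroup A) :
    dimHom R h (dimAut A x) = dimAut B (dimHom R h x) := by
  obtain ⟨v, n, rfl⟩ := exists_dimClass A x
  rw [dimAut_dimClass, dimHom_dimClass, dimHom_dimClass, dimAut_dimClass]

theorem dimAut_iterate_dimHom_dimHom (hR : A * R = R * B) (hS : B * S = S * A)
    (hRS : R * S = A ^ l) (x : DimGroup A) :
    (dimAut A)^[l] (dimHom S hS (dimHom R hR x)) = x := by
  obtain ⟨v, n, rfl⟩ := exists_dimClass A x
  rw [dimHom_dimClass, dimHom_dimClass, dimAut_iterate_dimClass, Matrix.mulVec_mulVec,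
    ← Matrix.transpose_mul, hRS, Matrix.transpose_pow, dimClass_pow_mulVec]

/-- An isomorphism of the dimension triplets `(Δ_A, Δ_A⁺, δ_A)` and `(Δ_B, Δ_B⁺, δ_B)`. -/
structure DimTripletEquiv (A : Matrix ι ι ℤ) (B : Matrix κ κ ℤ) extends
    DimGroup A ≃+ DimGroup B where
  mem_dimCone_iff : ∀ x, toAddEquiv x ∈ dimCone B ↔ x ∈ dimCone A
  map_dimAut : ∀ x, toAddEquiv (dimAut A x) = dimAut B (toAddEquiv x)

namespace DimTripletEquiv

/-- The inverse isomorphism of dimension triplets. -/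
noncomputable def symm (f : DimTripletEquiv A B) : DimTripletEquiv B A where
  toAddEquiv := f.toAddEquiv.symm
  mem_dimCone_iff y := by rw [← f.mem_dimCone_iff, AddEquiv.apply_symm_apply]
  map_dimAut y := by
    rw [AddEquiv.symm_apply_eq, f.map_dimAut, AddEquiv.apply_symm_apply]

theorem image_dimCone (f : DimTripletEquiv A B) : f.toAddEquiv '' dimCone A = dimCone B :=
  (f.toEquiv.image_eq_preimage_symm (dimCone A)).trans (Set.ext f.symm.mem_dimCone_iff)

theorem map_dimAut_symm (f : DimTripletEquiv A B) (x : DimGroup A) :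
    f.toAddEquiv ((dimAut A).symm x) = (dimAut B).symm (f.toAddEquiv x) := by
  rw [AddEquiv.eq_symm_apply, ← f.map_dimAut, AddEquiv.apply_symm_apply]

end DimTripletEquiv

/-- The isomorphism of dimension triplets `[v, n] ↦ [Rᵗ v, n]` induced by a shift equivalence, with
inverse `[w, n] ↦ [Sᵗ w, n + l]`. -/
noncomputable def IsShiftEquivalence.dimTripletEquiv (h : IsShiftEquivalence A B R S l) :
    DimTripletEquiv A B where
  toFun := dimHom R h.mul_left
  invFun y := (dimAut A)^[l] (dimHom S h.mul_right y)
  left_inv := dimAut_iterate_dimHom_dimHom h.mul_left h.mul_right h.left_mul_right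
  right_inv y := by
    rw [Function.Semiconj.iterate_right (dimHom_dimAut h.mul_left) l,
      dimAut_iterate_dimHom_dimHom h.mul_right h.mul_left h.right_mul_left]
  map_add' := map_add _
  mem_dimCone_iff x := by
    refine ⟨fun hx => ?_, dimHom_mem_dimCone h.mul_left h.left_nonneg⟩
    rw [← dimAut_iterate_dimHom_dimHom h.mul_left h.mul_right h.left_mul_right x]
    exact dimAut_iterate_mem_dimCone (dimHom_mem_dimCone h.mul_right h.right_nonneg hx) l
  map_dimAut := dimHom_dimAut h.mul_left

theorem IsShiftEquivalence.dimTripletEquiv_dimClass (h : IsShiftEquivalence A B R S l)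
    (v : ι → ℤ) (n : ℕ) :
    h.dimTripletEquiv.toAddEquiv (dimClass A v n) = dimClass B (Rᵀ *ᵥ v) n :=
  dimHom_dimClass h.mul_left v n

theorem IsShiftEquivalence.dimTripletEquiv_symm_dimClass (h : IsShiftEquivalence A B R S l)
    (w : κ → ℤ) (n : ℕ) :
    h.dimTripletEquiv.symm.toAddEquiv (dimClass B w n) = dimClass A (Sᵀ *ᵥ w) (n + l) := by
  change (dimAut A)^[l] (dimHom S h.mul_right (dimClass B w n)) = _
  rw [dimHom_dimClass, dimAut_iterate_dimClass]

/-! ### Dimension quadruplets -/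

theorem sum_mulVec_single_tmul {α M N : Type*} [CommSemiring α] [AddCommMonoid M] [Module α M]
    [AddCommMonoid N] [Module α N] (f : (κ → α) →ₗ[α] M) (g : (ι → α) →ₗ[α] N)
    (P : Matrix κ ι α) :
    ∑ i, f (P *ᵥ Pi.single i 1) ⊗ₜ[α] g (Pi.single i 1) =
      ∑ k, f (Pi.single k 1) ⊗ₜ[α] g (Pᵀ *ᵥ Pi.single k 1) := by
  simp only [Matrix.mulVec_single_one]
  calc ∑ i, f (P.col i) ⊗ₜ[α] g (Pi.single i 1)
      = ∑ i, ∑ k, P k i • (f (Pi.single k 1) ⊗ₜ[α] g (Pi.single i 1)) := by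
        refine Finset.sum_congr rfl fun i _ => ?_
        rw [pi_eq_sum_univ' (P.col i), map_sum, TensorProduct.sum_tmul]
        simp only [map_smul, TensorProduct.smul_tmul', Matrix.col_apply]
    _ = ∑ k, ∑ i, P k i • (f (Pi.single k 1) ⊗ₜ[α] g (Pi.single i 1)) := Finset.sum_comm
    _ = ∑ k, f (Pi.single k 1) ⊗ₜ[α] g (Pᵀ.col k) := by
        refine Finset.sum_congr rfl fun k _ => ?_
        rw [pi_eq_sum_univ' (Pᵀ.col k), map_sum, TensorProduct.tmul_sum]
        simp only [map_smul, TensorProduct.tmul_smul, Matrix.col_apply, Matrix.transpose_apply]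

theorem biDimUnit_eq_sum_tmul (A : Matrix ι ι ℤ) :
    biDimUnit A =
      ∑ k, dimClass Aᵀ (Pi.single k 1) 1 ⊗ₜ[ℤ] dimClass A (Pi.single k 1) 0 := by
  rw [biDimUnit, Finset.sum_comm]
  refine Finset.sum_congr rfl fun k _ => ?_
  rw [← TensorProduct.tmul_sum]
  congr 1
  calc ∑ i, A k i • dimClass A (Pi.single i 1) 1
      = dimClass A (A k) 1 := by
        simp only [← dimClassHom_apply, ← map_zsmul, ← map_sum]
        rw [← pi_eq_sum_univ' (A k)]
    _ = dimClass A (Aᵀ *ᵥ Pi.single k 1) (0 + 1) := by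
        rw [Matrix.mulVec_single_one]
        rfl
    _ = dimClass A (Pi.single k 1) 0 := dimClass_succ A _ 0

theorem biDimCone_eq_closure_image2 (A : Matrix ι ι ℤ) :
    biDimCone A = AddSubmonoid.closure (Set.image2 (· ⊗ₜ[ℤ] ·) (dimCone Aᵀ) (dimCone A)) := by
  simp only [biDimCone, Set.image2, eq_comm]

/-- The tensor product of isomorphisms of the dimension triplets of the transposes and of the
matrices themselves. -/
noncomputable def biDimEquiv (f : DimTripletEquiv Aᵀ Bᵀ) (g : DimTripletEquiv A B) :
    BiDimGroup A ≃+ BiDimGroup B :=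
  (TensorProduct.congr f.toAddEquiv.toIntLinearEquiv g.toAddEquiv.toIntLinearEquiv).toAddEquiv

theorem biDimEquiv_tmul (f : DimTripletEquiv Aᵀ Bᵀ) (g : DimTripletEquiv A B) (a : DimGroup Aᵀ)
    (b : DimGroup A) : biDimEquiv f g (a ⊗ₜ[ℤ] b) = f.toAddEquiv a ⊗ₜ[ℤ] g.toAddEquiv b :=
  rfl

theorem biDimAut_tmul (a : DimGroup Aᵀ) (b : DimGroup A) :
    biDimAut A (a ⊗ₜ[ℤ] b) = (dimAut Aᵀ).symm a ⊗ₜ[ℤ] dimAut A b :=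
  rfl

theorem biDimEquiv_image_biDimCone (f : DimTripletEquiv Aᵀ Bᵀ) (g : DimTripletEquiv A B) :
    biDimEquiv f g '' (biDimCone A : Set (BiDimGroup A)) = biDimCone B := by
  rw [biDimCone_eq_closure_image2, biDimCone_eq_closure_image2, ← AddSubmonoid.coe_map,
    AddMonoidHom.map_mclosure, Set.image_image2, ← f.image_dimCone, ← g.image_dimCone,
    Set.image2_image_left, Set.image2_image_right]
  rfl

theorem biDimEquiv_biDimAut (f : DimTripletEquiv Aᵀ Bᵀ) (g : DimTripletEquiv A B)
    (z : BiDimGroup A) : biDimEquiv f g (biDimAut A z) = biDimAut B (biDimEquiv f g z) := by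
  induction z using TensorProduct.induction_on with
  | zero => simp only [map_zero]
  | add x y hx hy => simp only [map_add, hx, hy]
  | tmul a b =>
    rw [biDimAut_tmul, biDimEquiv_tmul, biDimEquiv_tmul, biDimAut_tmul, f.map_dimAut_symm,
      g.map_dimAut]

theorem IsShiftEquivalence.biDimEquiv_biDimUnit (h : IsShiftEquivalence A B R S l) :
    biDimEquiv h.transpose.dimTripletEquiv h.symm.dimTripletEquiv.symm (biDimUnit A) =
      biDimUnit B := by
  rw [biDimUnit_eq_sum_tmul, biDimUnit_eq_sum_tmul, map_sum]
  simp only [biDimEquiv_tmul, dimTripletEquiv_dimClass, dimTripletEquiv_symm_dimClass,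
    Matrix.transpose_transpose]
  calc ∑ i, dimClass Bᵀ (S *ᵥ Pi.single i 1) 1 ⊗ₜ[ℤ] dimClass B (Rᵀ *ᵥ Pi.single i 1) (0 + l)
      = ∑ k, dimClass Bᵀ (Pi.single k 1) 1 ⊗ₜ[ℤ]
          dimClass B (Rᵀ *ᵥ (Sᵀ *ᵥ Pi.single k 1)) (0 + l) :=
        sum_mulVec_single_tmul (dimClassHom Bᵀ 1).toIntLinearMap
          ((dimClassHom B (0 + l)).toIntLinearMap ∘ₗ Rᵀ.mulVecLin) S
    _ = ∑ k, dimClass Bᵀ (Pi.single k 1) 1 ⊗ₜ[ℤ] dimClass B (Pi.single k 1) 0 := by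
        simp only [Matrix.mulVec_mulVec, ← Matrix.transpose_mul, h.right_mul_left,
          Matrix.transpose_pow, dimClass_pow_mulVec]

theorem IsShiftEquivalence.dimQuadrupletIso (h : IsShiftEquivalence A B R S l) :
    DimQuadrupletIso A B :=
  ⟨biDimEquiv h.transpose.dimTripletEquiv h.symm.dimTripletEquiv.symm,
    biDimEquiv_image_biDimCone _ _, biDimEquiv_biDimAut _ _, h.biDimEquiv_biDimUnit⟩

end ShiftEquivalence

/-! ### Presentations as a Markov shift -/

theorem exists_finset_forall_eq_imp_eq {X I K : Type*} {Y : I → Type*} [TopologicalSpace X]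
    [CompactSpace X] [∀ i, TopologicalSpace (Y i)] [∀ i, T2Space (Y i)] [TopologicalSpace K]
    [DiscreteTopology K] {g : ∀ i, X → Y i} (hg : ∀ i, Continuous (g i))
    (hinj : ∀ x y, (∀ i, g i x = g i y) → x = y) {f : X → K} (hf : Continuous f) :
    ∃ s : Finset I, ∀ x y, (∀ i ∈ s, g i x = g i y) → f x = f y := by
  have hne : IsClosed {z : X × X | f z.1 ≠ f z.2} :=
    (isClosed_discrete {w : K × K | w.1 ≠ w.2}).preimage (hf.prodMap hf)
  have heq (i : I) : IsClosed {z : X × X | g i z.1 = g i z.2} :=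
    isClosed_eq ((hg i).comp continuous_fst) ((hg i).comp continuous_snd)
  have hempty : {z : X × X | f z.1 ≠ f z.2} ∩ ⋂ i, {z | g i z.1 = g i z.2} = ∅ :=
    Set.eq_empty_of_forall_notMem fun z hz =>
      hz.1 (congrArg f (hinj _ _ (Set.mem_iInter.1 hz.2)))
  obtain ⟨s, hs⟩ := hne.isCompact.elim_finite_subfamily_closed _ heq hempty
  refine ⟨s, fun x y hxy => by_contra fun hfxy => ?_⟩
  exact Set.notMem_empty (x, y) (hs ▸ ⟨hfxy, Set.mem_iInter₂.2 hxy⟩)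

theorem isClosed_markovShift {ι : Type*} [TopologicalSpace ι] [DiscreteTopology ι]
    (A : Matrix ι ι ℤ) : IsClosed (MarkovShift A) := by
  have hclosed (n : ℤ) : IsClosed {x : ℤ → ι | A (x n) (x (n + 1)) = 1} :=
    (isClosed_discrete {z : ι × ι | A z.1 z.2 = 1}).preimage
      (f := fun x : ℤ → ι => (x n, x (n + 1))) (by fun_prop)
  rw [MarkovShift, Set.ofPred_forall]
  exact isClosed_iInter hclosed

theorem exists_mem_markovShift_apply_zero_eq {ι : Type*} {A : Matrix ι ι ℤ}
    (hrow : ∀ a, ∃ b, A a b = 1) (hcol : ∀ b, ∃ a, A a b = 1) (a : ι) :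
    ∃ x ∈ MarkovShift A, x 0 = a := by
  choose next hnext using hrow
  choose prev hprev using hcol
  refine ⟨fun n => Int.casesOn n (fun m => next^[m] a) (fun m => prev^[m + 1] a), fun n => ?_, rfl⟩
  match n with
  | Int.ofNat m =>
    change A (next^[m] a) (next^[m + 1] a) = 1
    rw [Function.iterate_succ_apply']
    exact hnext _
  | Int.negSucc 0 => exact hprev a
  | Int.negSucc (m + 1) =>
    change A (prev^[m + 1 + 1] a) (prev^[m + 1] a) = 1
    rw [Function.iterate_succ_apply']
    exact hprev _

/-- A presentation of the dynamical system `(X, σ)` as the two-sided Markov shift of `A`, in which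
every symbol occurs. A topological conjugacy is a pair of presentations of one system; in this form
the two shifts play symmetric roles. -/
structure MarkovPresentation {X ι : Type*} [TopologicalSpace X] [TopologicalSpace ι] (σ : X ≃ₜ X)
    (A : Matrix ι ι ℤ) where
  toHomeomorph : X ≃ₜ MarkovShift A
  map_apply : ∀ x, toHomeomorph (σ x) = markovShiftMap A (toHomeomorph x)
  exists_apply_zero_eq : ∀ a, ∃ x ∈ MarkovShift A, x 0 = a

namespace MarkovPresentation

variable {X ι κ τ : Type*} [TopologicalSpace X] [TopologicalSpace ι] [TopologicalSpace κ]
  [TopologicalSpace τ] {σ : X ≃ₜ X} {A : Matrix ι ι ℤ} {B : Matrix κ κ ℤ} {C : Matrix τ τ ℤ}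

section Points

variable (p : MarkovPresentation σ A)

/-- The symbol of the point `x` at time `n`. -/
def symbol (x : X) (n : ℤ) : ι := (p.toHomeomorph x).1 n

theorem apply_symbol_symbol_add_one (x : X) (n : ℤ) :
    A (p.symbol x n) (p.symbol x (n + 1)) = 1 :=
  (p.toHomeomorph x).2 n

theorem symbol_injective : Function.Injective p.symbol :=
  Subtype.val_injective.comp p.toHomeomorph.injective

theorem continuous_symbol (n : ℤ) : Continuous (p.symbol · n) :=
  (continuous_apply n).comp (continuous_subtype_val.comp p.toHomeomorph.continuous)

theorem exists_symbol_eq {w : ℤ → ι} (hw : w ∈ MarkovShift A) : ∃ x, p.symbol x = w :=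
  ⟨p.toHomeomorph.symm ⟨w, hw⟩, congrArg Subtype.val (p.toHomeomorph.apply_symm_apply _)⟩

theorem symbol_map (x : X) (n : ℤ) : p.symbol (σ x) n = p.symbol x (n + 1) :=
  congrFun (congrArg Subtype.val (p.map_apply x)) n

theorem symbol_zpow (m : ℤ) (x : X) (n : ℤ) : p.symbol ((σ ^ m) x) n = p.symbol x (n + m) := by
  induction m generalizing x with
  | zero => rw [zpow_zero, add_zero]; rfl
  | succ i ih =>
    rw [zpow_add_one, Homeomorph.mul_apply, ih, symbol_map, add_assoc]
  | pred i ih =>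
    have hσ : p.symbol (σ⁻¹ x) (n + -i) = p.symbol x (n + -i - 1) := by
      conv_rhs => rw [← Homeomorph.apply_symm_apply σ x]
      rw [symbol_map, sub_add_cancel]
      rfl
    rw [zpow_sub_one, Homeomorph.mul_apply, ih, hσ, add_sub_assoc]

/-- The points `x` and `y` have the same symbols up to time `j`. -/
def PastEq (j : ℤ) (x y : X) : Prop := ∀ n ≤ j, p.symbol x n = p.symbol y n

/-- The points `x` and `y` have the same symbols from time `j` on. -/
def FutureEq (j : ℤ) (x y : X) : Prop := ∀ n ≥ j, p.symbol x n = p.symbol y n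

variable {p} {i j : ℤ} {x y z : X}

theorem PastEq.symm (h : p.PastEq j x y) : p.PastEq j y x := fun n hn => (h n hn).symm

theorem PastEq.trans (h : p.PastEq j x y) (h' : p.PastEq j y z) : p.PastEq j x z :=
  fun n hn => (h n hn).trans (h' n hn)

theorem FutureEq.symm (h : p.FutureEq j x y) : p.FutureEq j y x := fun n hn => (h n hn).symm

theorem FutureEq.trans (h : p.FutureEq j x y) (h' : p.FutureEq j y z) : p.FutureEq j x z :=
  fun n hn => (h n hn).trans (h' n hn)

theorem PastEq.eq_of_futureEq (h : p.PastEq i x y) (h' : p.FutureEq j x y) (hij : j ≤ i + 1) :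
    x = y :=
  p.symbol_injective <| funext fun n => (le_or_gt n i).elim (h n) fun hn => h' n (by lia)

theorem pastEq_zpow_iff (m : ℤ) :
    p.PastEq j ((σ ^ m) x) ((σ ^ m) y) ↔ p.PastEq (j + m) x y := by
  simp only [PastEq, symbol_zpow]
  exact ⟨fun h n hn => by simpa only [sub_add_cancel] using h (n - m) (by lia),
    fun h n hn => h _ (by lia)⟩

theorem futureEq_zpow_iff (m : ℤ) :
    p.FutureEq j ((σ ^ m) x) ((σ ^ m) y) ↔ p.FutureEq (j + m) x y := by
  simp only [FutureEq, symbol_zpow]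
  exact ⟨fun h n hn => by simpa only [sub_add_cancel] using h (n - m) (by lia),
    fun h n hn => h _ (by lia)⟩

variable (p)

theorem exists_pastEq_futureEq_add_one (h : A (p.symbol x j) (p.symbol y (j + 1)) = 1) :
    ∃ z, p.PastEq j z x ∧ p.FutureEq (j + 1) z y := by
  have hw : (fun n => if n ≤ j then p.symbol x n else p.symbol y n) ∈ MarkovShift A := fun n => by
    rcases lt_trichotomy n j with hn | rfl | hn
    · simpa only [if_pos hn.le, if_pos (show n + 1 ≤ j by lia)] using
        p.apply_symbol_symbol_add_one x n
    · simpa only [le_refl, if_true, if_neg (show ¬ n + 1 ≤ n by lia)] using h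
    · simpa only [if_neg hn.not_ge, if_neg (show ¬ n + 1 ≤ j by lia)] using
        p.apply_symbol_symbol_add_one y n
  obtain ⟨z, hz⟩ := p.exists_symbol_eq hw
  exact ⟨z, fun n hn => by rw [hz]; exact if_pos hn, fun n hn => by rw [hz]; exact if_neg (by lia)⟩

theorem exists_pastEq_futureEq (h : p.symbol x j = p.symbol y j) :
    ∃ z, p.PastEq j z x ∧ p.FutureEq j z y := by
  obtain ⟨z, hpast, hfuture⟩ := p.exists_pastEq_futureEq_add_one (x := x) (y := y) (j := j)
    (by rw [h]; exact p.apply_symbol_symbol_add_one y j)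
  refine ⟨z, hpast, fun n hn => ?_⟩
  rcases hn.eq_or_lt with rfl | hn
  · exact (hpast j le_rfl).trans h
  · exact hfuture n (by lia)

theorem exists_symbol_zero_eq (a : ι) : ∃ x, p.symbol x 0 = a := by
  obtain ⟨w, hw, rfl⟩ := p.exists_apply_zero_eq a
  obtain ⟨x, rfl⟩ := p.exists_symbol_eq hw
  exact ⟨x, rfl⟩

/-- A chosen point with symbol `a` at time `j`. The choice is made at time `0` and then shifted, so
that the reference points are permuted by `σ`. -/
noncomputable def refPoint (j : ℤ) (a : ι) : X :=
  (σ ^ (-j)) (p.exists_symbol_zero_eq a).choose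

theorem symbol_refPoint (j : ℤ) (a : ι) : p.symbol (p.refPoint j a) j = a := by
  rw [refPoint, symbol_zpow, add_neg_cancel]
  exact (p.exists_symbol_zero_eq a).choose_spec

theorem zpow_refPoint (m j : ℤ) (a : ι) : (σ ^ m) (p.refPoint (j + m) a) = p.refPoint j a := by
  rw [refPoint, ← Homeomorph.mul_apply, ← zpow_add, neg_add_rev, add_neg_cancel_left, refPoint]

end Points

/-- The symbol of `q` at a time is determined by the symbols of `p` in the window of radius `k`
around that time. By equivariance it is enough to require this at time `0`. -/
def Determines (p : MarkovPresentation σ A) (k : ℕ) (q : MarkovPresentation σ B) : Prop :=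
  ∀ x y, (∀ n ∈ Set.Icc (-k : ℤ) k, p.symbol x n = p.symbol y n) → q.symbol x 0 = q.symbol y 0

section Determines

variable {p : MarkovPresentation σ A} {q : MarkovPresentation σ B} {k : ℕ}

theorem determines_self (p : MarkovPresentation σ A) : p.Determines 0 p :=
  fun _ _ h => h 0 (by simp)

theorem Determines.mono (h : p.Determines k q) {l : ℕ} (hkl : k ≤ l) : p.Determines l q :=
  fun x y hxy => h x y fun n hn => hxy n ⟨by have := hn.1; lia, by have := hn.2; lia⟩

theorem Determines.symbol_eq (h : p.Determines k q) {x y : X} {m : ℤ}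
    (hxy : ∀ n ∈ Set.Icc (m - k) (m + k), p.symbol x n = p.symbol y n) :
    q.symbol x m = q.symbol y m := by
  have := h ((σ ^ m) x) ((σ ^ m) y) fun n hn => by
    rw [symbol_zpow, symbol_zpow]
    exact hxy _ ⟨by have := hn.1; lia, by have := hn.2; lia⟩
  simpa only [symbol_zpow, zero_add] using this

theorem PastEq.of_determines (h : p.Determines k q) {i j : ℤ} (hij : i + k ≤ j) {x y : X}
    (hxy : p.PastEq j x y) : q.PastEq i x y :=
  fun n hn => h.symbol_eq fun s hs => hxy s (by have := hs.2; lia)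

theorem FutureEq.of_determines (h : p.Determines k q) {i j : ℤ} (hij : i + k ≤ j) {x y : X}
    (hxy : p.FutureEq i x y) : q.FutureEq j x y :=
  fun n hn => h.symbol_eq fun s hs => hxy s (by have := hs.1; lia)

theorem exists_determines [Finite ι] [DiscreteTopology ι] [DiscreteTopology κ]
    (p : MarkovPresentation σ A) (q : MarkovPresentation σ B) : ∃ k, p.Determines k q := by
  have : CompactSpace (MarkovShift A) :=
    isCompact_iff_compactSpace.1 (isClosed_markovShift A).isCompact
  have : CompactSpace X := p.toHomeomorph.symm.compactSpace
  obtain ⟨s, hs⟩ := exists_finset_forall_eq_imp_eq p.continuous_symbol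
    (fun x y h => p.symbol_injective (funext h)) (q.continuous_symbol 0)
  refine ⟨s.sup Int.natAbs, fun x y hxy => hs x y fun n hn => hxy n ?_⟩
  have : n.natAbs ≤ s.sup Int.natAbs := Finset.le_sup (f := Int.natAbs) hn
  exact ⟨by lia, by lia⟩

end Determines

/-! ### Counting points with prescribed past and future -/

/-- The points whose `p`-past up to time `i` is that of the reference point of `a` and whose
`q`-future from time `j` on is that of the reference point of `b`. -/
def transit (p : MarkovPresentation σ A) (q : MarkovPresentation σ B) (i j : ℤ) (a : ι) (b : κ) :
    Set X :=
  {x | p.PastEq i x (p.refPoint i a) ∧ q.FutureEq j x (q.refPoint j b)}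

section Transit

variable (p : MarkovPresentation σ A) (q : MarkovPresentation σ B) (r : MarkovPresentation σ C)

theorem finite_transit [Finite ι] [DiscreteTopology ι] [Finite κ] [DiscreteTopology κ] (i j : ℤ)
    (a : ι) (b : κ) : Finite (p.transit q i j a b) := by
  obtain ⟨k, hqp⟩ := q.exists_determines p
  refine Finite.of_injective (β := Set.Icc i (j + k) → ι)
    (fun x n => p.symbol x n) fun x y hxy => Subtype.ext (p.symbol_injective (funext fun n => ?_))
  have hpast : p.PastEq i x y := x.2.1.trans y.2.1.symm
  have hfuture : p.FutureEq (j + k) x y :=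
    (x.2.2.trans y.2.2.symm).of_determines hqp le_rfl
  rcases le_total n i with hn | hn
  · exact hpast n hn
  rcases le_total n (j + k) with hn' | hn'
  · exact congrFun hxy ⟨n, hn, hn'⟩
  · exact hfuture n hn'

theorem card_transit_add (i j m : ℤ) (a : ι) (b : κ) :
    Nat.card (p.transit q (i + m) (j + m) a b) = Nat.card (p.transit q i j a b) :=
  Nat.card_congr <| (σ ^ m).toEquiv.subtypeEquiv fun x => by
    change p.PastEq _ x _ ∧ q.FutureEq _ x _ ↔ p.PastEq i ((σ ^ m) x) _ ∧ q.FutureEq j ((σ ^ m) x) _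
    rw [← p.zpow_refPoint m i a, ← q.zpow_refPoint m j b, pastEq_zpow_iff, futureEq_zpow_iff]

variable {p q r}

theorem card_transit_fiber {k l : ℕ} (hqp : q.Determines k p) (hqr : q.Determines l r) {i j m : ℤ}
    (hij : i + k ≤ j) (hjm : j + l ≤ m) (a : ι) (b : κ) (c : τ) :
    Nat.card {x : p.transit r i m a c // q.symbol x j = b} =
      Nat.card (p.transit q i j a b) * Nat.card (q.transit r j m b c) := by
  have hcut (x : {x : p.transit r i m a c // q.symbol x j = b}) :
      ∃ yz : p.transit q i j a b × q.transit r j m b c,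
        q.PastEq j yz.1 x.1 ∧ q.FutureEq j yz.2 x.1 := by
    have hb : q.symbol x.1 j = q.symbol (q.refPoint j b) j := x.2.trans (q.symbol_refPoint j b).symm
    obtain ⟨y, hyx, hyb⟩ := q.exists_pastEq_futureEq hb
    obtain ⟨z, hzb, hzx⟩ := q.exists_pastEq_futureEq hb.symm
    exact ⟨(⟨y, (hyx.of_determines hqp hij).trans x.1.2.1, hyb⟩,
      ⟨z, hzb, (hzx.of_determines hqr hjm).trans x.1.2.2⟩), hyx, hzx⟩
  choose cut hpast hfuture using hcut
  rw [← Nat.card_prod]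
  refine Nat.card_eq_of_bijective cut ⟨fun x x' h => ?_, fun yz => ?_⟩
  · have hxx' : q.PastEq j x.1 x'.1 := (hpast x).symm.trans (h ▸ hpast x')
    exact Subtype.ext <| Subtype.ext <|
      hxx'.eq_of_futureEq ((hfuture x).symm.trans (h ▸ hfuture x')) (by lia)
  · have hy : q.symbol yz.1 j = b := (yz.1.2.2 j le_rfl).trans (q.symbol_refPoint j b)
    have hz : q.symbol yz.2 j = b := (yz.2.2.1 j le_rfl).trans (q.symbol_refPoint j b)
    obtain ⟨x, hxy, hxz⟩ := q.exists_pastEq_futureEq (hy.trans hz.symm)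
    refine ⟨⟨⟨x, (hxy.of_determines hqp hij).trans yz.1.2.1,
      (hxz.of_determines hqr hjm).trans yz.2.2.2⟩, (hxy j le_rfl).trans hy⟩, Prod.ext ?_ ?_⟩
    · exact Subtype.ext <| ((hpast _).trans hxy).eq_of_futureEq
        ((cut _).1.2.2.trans yz.1.2.2.symm) (by lia)
    · exact Subtype.ext <| ((cut _).2.2.1.trans yz.2.2.1.symm).eq_of_futureEq
        ((hfuture _).trans hxz) (by lia)

theorem card_transit_eq_sum [Finite ι] [DiscreteTopology ι] [Fintype κ] [Finite τ]
    [DiscreteTopology τ] {k l : ℕ} (hqp : q.Determines k p) (hqr : q.Determines l r) {i j m : ℤ}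
    (hij : i + k ≤ j) (hjm : j + l ≤ m) (a : ι) (c : τ) :
    Nat.card (p.transit r i m a c) =
      ∑ b, Nat.card (p.transit q i j a b) * Nat.card (q.transit r j m b c) := by
  have := p.finite_transit r i m a c
  rw [← Nat.card_congr (Equiv.sigmaFiberEquiv fun x : p.transit r i m a c => q.symbol x j),
    Nat.card_sigma]
  refine Finset.sum_congr rfl fun b _ => ?_
  rw [card_transit_fiber hqp hqr hij hjm a b c]

end Transit

/-- The matrix counting the points in transit from a `p`-symbol at time `0` to a `q`-symbol at
time `n`. -/
noncomputable def transfer (p : MarkovPresentation σ A) (q : MarkovPresentation σ B) (n : ℕ) :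
    Matrix ι κ ℤ :=
  Matrix.of fun a b => (Nat.card (p.transit q 0 n a b) : ℤ)

section Transfer

variable (p : MarkovPresentation σ A) {q : MarkovPresentation σ B} {r : MarkovPresentation σ C}

theorem transfer_apply (q : MarkovPresentation σ B) (n : ℕ) (a : ι) (b : κ) :
    p.transfer q n a b = Nat.card (p.transit q 0 n a b) :=
  rfl

theorem transfer_nonneg (q : MarkovPresentation σ B) (n : ℕ) (a : ι) (b : κ) :
    0 ≤ p.transfer q n a b :=
  Int.natCast_nonneg _

theorem transfer_mul_transfer [Finite ι] [DiscreteTopology ι] [Fintype κ] [Finite τ]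
    [DiscreteTopology τ] {p : MarkovPresentation σ A} {m n : ℕ} (hqp : q.Determines m p)
    (hqr : q.Determines n r) : p.transfer q m * q.transfer r n = p.transfer r (m + n) := by
  ext a c
  rw [Matrix.mul_apply, transfer_apply, Nat.cast_add,
    card_transit_eq_sum hqp hqr (zero_add (m : ℤ)).le le_rfl, Nat.cast_sum]
  refine Finset.sum_congr rfl fun b _ => ?_
  have hshift := q.card_transit_add r 0 n m b c
  rw [zero_add, add_comm] at hshift
  rw [transfer_apply, transfer_apply, hshift, Nat.cast_mul]

theorem card_transit_self_of_nonempty {i j : ℤ} (hij : j ≤ i + 1) {a b : ι}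
    (h : (p.transit p i j a b).Nonempty) : Nat.card (p.transit p i j a b) = 1 := by
  have : Nonempty (p.transit p i j a b) := h.to_subtype
  have : Subsingleton (p.transit p i j a b) := ⟨fun x y => Subtype.ext <|
    (x.2.1.trans y.2.1.symm).eq_of_futureEq (x.2.2.trans y.2.2.symm) hij⟩
  exact Nat.card_eq_one_iff_unique.2 ⟨this, ‹_›⟩

theorem transfer_self_zero [DecidableEq ι] : p.transfer p 0 = 1 := by
  ext a b
  rw [transfer_apply]
  rcases eq_or_ne a b with rfl | hab
  · rw [Matrix.one_apply_eq, Nat.cast_eq_one]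
    exact p.card_transit_self_of_nonempty (by simp) ⟨p.refPoint 0 a, fun _ _ => rfl, fun _ _ => rfl⟩
  · rw [Matrix.one_apply_ne hab]
    have : IsEmpty (p.transit p 0 (0 : ℕ) a b) := ⟨fun x => hab <| by
      rw [← p.symbol_refPoint 0 a, ← x.2.1 0 le_rfl, x.2.2 0 le_rfl]
      exact p.symbol_refPoint 0 b⟩
    rw [Nat.card_of_isEmpty, Nat.cast_zero]

theorem transit_self_zero_one_nonempty_iff {a b : ι} :
    (p.transit p 0 1 a b).Nonempty ↔ A a b = 1 := by
  constructor
  · rintro ⟨x, hpast, hfuture⟩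
    have hedge := p.apply_symbol_symbol_add_one x 0
    rwa [zero_add, hpast 0 le_rfl, hfuture 1 le_rfl, symbol_refPoint, symbol_refPoint] at hedge
  · intro h
    exact p.exists_pastEq_futureEq_add_one (j := 0) (by
      rwa [zero_add, symbol_refPoint, symbol_refPoint])

theorem transfer_self_one (hA : ∀ i j, A i j = 0 ∨ A i j = 1) : p.transfer p 1 = A := by
  ext a b
  rw [transfer_apply, Nat.cast_one]
  rcases hA a b with h | h
  · have hempty : p.transit p 0 1 a b = ∅ := by
      rw [← Set.not_nonempty_iff_eq_empty, transit_self_zero_one_nonempty_iff, h]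
      exact zero_ne_one
    rw [hempty, Nat.card_of_isEmpty, h, Nat.cast_zero]
  · rw [h, p.card_transit_self_of_nonempty (zero_add 1).ge
      (p.transit_self_zero_one_nonempty_iff.2 h), Nat.cast_one]

theorem transfer_self [Fintype ι] [DecidableEq ι] [DiscreteTopology ι]
    (hA : ∀ i j, A i j = 0 ∨ A i j = 1) (n : ℕ) : p.transfer p n = A ^ n := by
  induction n with
  | zero => rw [transfer_self_zero, pow_zero]
  | succ n ih =>
    rw [pow_succ, ← ih, ← transfer_mul_transfer (p.determines_self.mono n.zero_le)
      (p.determines_self.mono zero_le_one), p.transfer_self_one hA]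

theorem mul_transfer [Fintype ι] [DiscreteTopology ι] [Finite κ] [DiscreteTopology κ]
    (hA : ∀ i j, A i j = 0 ∨ A i j = 1) {k : ℕ} (hpq : p.Determines k q) :
    A * p.transfer q k = p.transfer q (1 + k) := by
  have hmul := transfer_mul_transfer (p.determines_self.mono zero_le_one) hpq
  rwa [p.transfer_self_one hA] at hmul

theorem transfer_mul [Finite ι] [DiscreteTopology ι] [Fintype κ] [DiscreteTopology κ]
    {p : MarkovPresentation σ A} (hB : ∀ i j, B i j = 0 ∨ B i j = 1) {k : ℕ}
    (hqp : q.Determines k p) : p.transfer q k * B = p.transfer q (k + 1) := by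
  have hmul := transfer_mul_transfer hqp (q.determines_self.mono zero_le_one)
  rwa [q.transfer_self_one hB] at hmul

theorem exists_isShiftEquivalence [Fintype ι] [DecidableEq ι] [DiscreteTopology ι] [Fintype κ]
    [DecidableEq κ] [DiscreteTopology κ] (hA : ∀ i j, A i j = 0 ∨ A i j = 1)
    (hB : ∀ i j, B i j = 0 ∨ B i j = 1) (p : MarkovPresentation σ A)
    (q : MarkovPresentation σ B) : ∃ R S l, IsShiftEquivalence A B R S l := by
  obtain ⟨k₁, hk₁⟩ := p.exists_determines q
  obtain ⟨k₂, hk₂⟩ := q.exists_determines p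
  have hpq : p.Determines (max k₁ k₂) q := hk₁.mono (le_max_left ..)
  have hqp : q.Determines (max k₁ k₂) p := hk₂.mono (le_max_right ..)
  refine ⟨p.transfer q (max k₁ k₂), q.transfer p (max k₁ k₂), max k₁ k₂ + max k₁ k₂,
    p.transfer_nonneg q _, q.transfer_nonneg p _, ?_, ?_, ?_, ?_⟩
  · rw [p.mul_transfer hA hpq, add_comm, transfer_mul hB hqp]
  · rw [q.mul_transfer hB hqp, add_comm, transfer_mul hA hpq]
  · rw [transfer_mul_transfer hqp hqp, p.transfer_self hA]
  · rw [transfer_mul_transfer hpq hpq, q.transfer_self hB]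

end Transfer

end MarkovPresentation

theorem exists_eq_one_of_isIrreducible {ι : Type*} {A : Matrix ι ι ℤ}
    (hA : ∀ i j, A i j = 0 ∨ A i j = 1) (hirr : A.IsIrreducible) (b : ι) : ∃ a, A a b = 1 := by
  let := A.toQuiver
  obtain ⟨P, hP⟩ := hirr.connected b b
  obtain ⟨a, _, e, _⟩ := (Quiver.Path.length_ne_zero_iff_eq_cons P).1 hP.ne'
  exact ⟨a, (hA a b).resolve_left e.down.ne'⟩

theorem TopologicallyConjugate.exists_isShiftEquivalence {ι κ : Type*} [Fintype ι] [DecidableEq ι]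
    [TopologicalSpace ι] [DiscreteTopology ι] [Fintype κ] [DecidableEq κ] [TopologicalSpace κ]
    [DiscreteTopology κ] {A : Matrix ι ι ℤ} {B : Matrix κ κ ℤ}
    (hA01 : ∀ i j, A i j = 0 ∨ A i j = 1) (hB01 : ∀ i j, B i j = 0 ∨ B i j = 1)
    (hArow : ∀ i, ∃ j, A i j = 1) (hAcol : ∀ j, ∃ i, A i j = 1)
    (hBrow : ∀ i, ∃ j, B i j = 1) (hBcol : ∀ j, ∃ i, B i j = 1)
    (hconj : TopologicallyConjugate A B) : ∃ R S l, IsShiftEquivalence A B R S l := by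
  obtain ⟨h, hh⟩ := hconj
  let p : MarkovPresentation (markovShiftMap A) A :=
    ⟨Homeomorph.refl _, fun _ => rfl, exists_mem_markovShift_apply_zero_eq hArow hAcol⟩
  let q : MarkovPresentation (markovShiftMap A) B :=
    ⟨h, hh, exists_mem_markovShift_apply_zero_eq hBrow hBcol⟩
  exact p.exists_isShiftEquivalence hA01 hB01 q

theorem mainTheorem10_general {ι κ : Type*} [Fintype ι] [DecidableEq ι] [TopologicalSpace ι]
    [DiscreteTopology ι] [Fintype κ] [DecidableEq κ] [TopologicalSpace κ] [DiscreteTopology κ]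
    (A : Matrix ι ι ℤ) (B : Matrix κ κ ℤ)
    (hA01 : ∀ i j, A i j = 0 ∨ A i j = 1) (hB01 : ∀ i j, B i j = 0 ∨ B i j = 1)
    (hArow : ∀ i, ∃ j, A i j = 1) (hAcol : ∀ j, ∃ i, A i j = 1)
    (hBrow : ∀ i, ∃ j, B i j = 1) (hBcol : ∀ j, ∃ i, B i j = 1)
    (hconj : TopologicallyConjugate A B) :
    DimQuadrupletIso A B := by
  obtain ⟨R, S, l, h⟩ :=
    hconj.exists_isShiftEquivalence hA01 hB01 hArow hAcol hBrow hBcol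
  exact h.dimQuadrupletIso

theorem mainTheorem10 {N M : ℕ} (A : Matrix (Fin N) (Fin N) ℤ) (B : Matrix (Fin M) (Fin M) ℤ)
    (hA01 : ∀ i j, A i j = 0 ∨ A i j = 1) (hB01 : ∀ i j, B i j = 0 ∨ B i j = 1)
    (hAirr : A.IsIrreducible) (hBirr : B.IsIrreducible)
    (hAperm : ¬ IsPermutationMatrix A) (hBperm : ¬ IsPermutationMatrix B)
    (hconj : TopologicallyConjugate A B) :
    DimQuadrupletIso A B :=
  mainTheorem10_general A B hA01 hB01
    (exists_eq_one_of_isIrreducible (fun i j => hA01 j i) hAirr.transpose)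
    (exists_eq_one_of_isIrreducible hA01 hAirr)
    (exists_eq_one_of_isIrreducible (fun i j => hB01 j i) hBirr.transpose)
    (exists_eq_one_of_isIrreducible hB01 hBirr) hconj
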